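/- Let $M$ be a smooth ($C^\infty$, Hausdorff, second countable) manifold of dimension $2m$. An \emph{almost paracomplex structure} on a manifold is a smooth $(1,1)$ tensor field $J$ with $J^2=\mathrm{id}$ whose eigenbundles for the eigenvalues $+1$ and $-1$ have the same rank. It is a \emph{paracomplex structure} if it is integrable, i.e. if around every point there are smooth local coordinates $(x^1,\dots,x^k,y^1,\dots,y^k)$ with $J(\partial/\partial x^\alpha)=\partial/\partial y^\alpha$ and $J(\partial/\partial y^\alpha)=\partial/\partial x^\alpha$ for all $\alpha$. For a smooth $(1,1)$ tensor field $F$ on $M$, the \emph{complete lift} $F^c$ is the smooth $(1,1)$ tensor field on the tangent bundle $TM$ with $F^c(Z^c)=(FZ)^c$ for all smooth vector fields $Z$ on $M$. Here, in the coordinates $(z^i,z'^i)$ of $TM$ induced by coordinates $(z^i)$ of $M$, $Z^c = Z^i\,\partial/\partial z^i + \big(z'^j\,\partial Z^i/\partial z^j\big)\,\partial/\partial z'^i$ is the complete lift of $Z=Z^i\,\partial/\partial z^i$. In these coordinates $F^c$ is the block matrix $\begin{pmatrix}F&0\\ z'^j\partial_jF&F\end{pmatrix}$. \textbf{Corollary.}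 Let $J$ be a paracomplex structure on $M$. Then: (a) the complete lift $J^c$ is a paracomplex structure on $TM$ (in particular it is integrable); (b) the Nijenhuis tensor of $J^c$ vanishes: for all smooth vector fields $Z,W$ on $TM$, $$[Z,W]-J^c[J^cZ,W]-J^c[Z,J^cW]+[J^cZ,J^cW]=0;$$ (c) there is a smooth affine connection $\nabla$ on $TM$ (a covariant derivative on the tangent bundle of the manifold $TM$) which preserves $J^c$, i.e. $\nabla_X(J^cY)=J^c\nabla_XY$ for all smooth vector fields $X,Y$ on $TM$, and which is torsion-free, i.e. $\nabla_XY-\nabla_YX=[X,Y]$. -/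

import Mathlib

open Bundle
open scoped Manifold ContDiff

noncomputable section

namespace ParaLift

section Structures

variable {E : Type*} [NormedAddCommGroup E] [NormedSpace ℝ E]
  {H : Type*} [TopologicalSpace H] (I : ModelWithCorners ℝ E H)
  (M : Type*) [TopologicalSpace M] [ChartedSpace H M]

/-- A vector field on `M` (smoothness is a separate property). -/
abbrev VField := Π p : M, TangentSpace I p

/-- A tensor field of type `(1,1)` on `M`, viewed as a field of endomorphisms of the tangent
spaces (smoothness is a separate property). -/
abbrev EndField := Π p : M, TangentSpace I p →L[ℝ] TangentSpace I p

variable {I M}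

/-- The vector field `F Z`. -/
def EndField.applyField (F : EndField I M) (Z : VField I M) : VField I M :=
  fun p ↦ F p (Z p)

/-- The Nijenhuis tensor `N_J(Z, W) = [Z, W] - J[JZ, W] - J[Z, JW] + [JZ, JW]`, evaluated on
vector fields. -/
def nijenhuis (J : EndField I M) (Z W : VField I M) : VField I M := fun p ↦
  VectorField.mlieBracket I Z W p
    - J p (VectorField.mlieBracket I (J.applyField Z) W p)
    - J p (VectorField.mlieBracket I Z (J.applyField W) p)
    + VectorField.mlieBracket I (J.applyField Z) (J.applyField W) p

variable [IsManifold I ∞ M]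

/-- Smoothness of a vector field, as a section of the tangent bundle. -/
def VField.IsSmooth (Z : VField I M) : Prop :=
  ContMDiff I I.tangent ∞ (fun p : M ↦ (⟨p, Z p⟩ : TangentBundle I M))

/-- Smoothness of a `(1,1)` tensor field, as a section of the bundle `Hom(TM, TM)`. -/
def EndField.IsSmooth (F : EndField I M) : Prop :=
  ContMDiff I (I.prod 𝓘(ℝ, E →L[ℝ] E)) ∞ (fun p : M ↦
    (⟨p, F p⟩ : TotalSpace (E →L[ℝ] E) (fun p : M ↦ TangentSpace I p →L[ℝ] TangentSpace I p)))

/-- An almost paracomplex structure: a smooth `(1,1)` tensor field `J` with `J² = id` whose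
eigenbundles for the eigenvalues `1` and `-1` have the same rank. -/
structure IsAlmostParacomplex (J : EndField I M) : Prop where
  smooth : J.IsSmooth
  sq : ∀ (p : M) (v : TangentSpace I p), J p (J p v) = v
  rank_eq : ∀ p : M,
    Module.finrank ℝ (Module.End.eigenspace (J p : Module.End ℝ (TangentSpace I p)) 1) =
      Module.finrank ℝ (Module.End.eigenspace (J p : Module.End ℝ (TangentSpace I p)) (-1))

/-- A paracomplex structure: an almost paracomplex structure which is integrable as a
`G`-structure. Around every point there are smooth local coordinates
`(x¹, …, xᵐ, y¹, …, yᵐ) = L ∘ φ` in which `J (∂/∂xᵅ) = ∂/∂yᵅ` and `J (∂/∂yᵅ) = ∂/∂xᵅ`,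
that is, in which `J` exchanges the `x`-components and the `y`-components of a tangent vector. -/
structure IsParacomplex (J : EndField I M) : Prop extends IsAlmostParacomplex J where
  integrable : ∀ p : M, ∃ φ ∈ IsManifold.maximalAtlas I ∞ M, p ∈ φ.source ∧
    ∃ (m : ℕ) (L : E ≃L[ℝ] (Fin m → ℝ) × (Fin m → ℝ)),
      ∀ q ∈ φ.source, ∀ v : TangentSpace I q,
        L (mfderiv I 𝓘(ℝ, E) (φ.extend I) q (J q v)) =
          (L (mfderiv I 𝓘(ℝ, E) (φ.extend I) q v)).swap

end Structures

section Lifts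

variable {E : Type*} [NormedAddCommGroup E] [NormedSpace ℝ E]
  {H : Type*} [TopologicalSpace H] {I : ModelWithCorners ℝ E H}
  {M : Type*} [TopologicalSpace M] [ChartedSpace H M] [IsManifold I ∞ M]

/-- The components of the vector field `Z` at points `p'` near `p`, in the coordinates given by
the preferred chart at `p`. -/
def VField.coord (Z : VField I M) (p p' : M) : E :=
  (trivializationAt E (TangentSpace I : M → Type _) p).continuousLinearMapAt ℝ p' (Z p')

/-- The matrix of the tensor field `F` at points `p'` near `p`, in the coordinates given by the
preferred chart at `p`. -/
def EndField.coord (F : EndField I M) (p p' : M) : E →L[ℝ] E :=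
  ContinuousLinearMap.inCoordinates E (TangentSpace I : M → Type _) E
    (TangentSpace I : M → Type _) p p' p p' (F p')

/-- The complete lift `Z^c` of a vector field to the tangent bundle. At a point `(p, v)` of `TM`,
the tangent space to `TM` is `E × E` through the coordinates `(z, z')` of `TM` induced by the
preferred chart at `p`, and `Z^c` has the components `((Zᵅ)^v, (Zᵅ)^c)`, where `f^v (p, v) = f p`
and `f^c (p, v) = df_p(v)` are the vertical and complete lifts of functions. -/
def VField.completeLift (Z : VField I M) : VField I.tangent (TangentBundle I M) :=
  fun q ↦ ((Z q.proj : E), (mfderiv I 𝓘(ℝ, E) (Z.coord q.proj) q.proj q.snd : E))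

/-- The complete lift `F^c` of a `(1,1)` tensor field to the tangent bundle. In the coordinates
`(z, z')` of `TM` induced by the preferred chart at the base point it is the block matrix
with rows `(F^v, 0)` and `(F^c, F^v)`, where the vertical and complete lifts of the matrix of `F`
are taken entrywise. -/
def EndField.completeLift (F : EndField I M) : EndField I.tangent (TangentBundle I M) :=
  fun q ↦
    let A : E →L[ℝ] E := F q.proj
    let B : E →L[ℝ] E :=
      mfderiv I 𝓘(ℝ, E →L[ℝ] E) (F.coord q.proj) q.proj q.snd
    (A.comp (ContinuousLinearMap.fst ℝ E E)).prod
      (B.comp (ContinuousLinearMap.fst ℝ E E) + A.comp (ContinuousLinearMap.snd ℝ E E))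

/-- At the base point itself the components are those of the vector. -/
theorem VField.coord_self (Z : VField I M) (p : M) : Z.coord p p = (Z p : E) := by
  have h := TangentBundle.continuousLinearMapAt_trivializationAt_eq_core (I := I)
    (mem_chart_source H p)
  unfold VField.coord
  rw [h]
  exact (tangentBundleCore I M).coordChange_self _ _ (mem_chart_source H p) _

/-- At the base point itself the matrix is that of the endomorphism. -/
theorem EndField.coord_self (F : EndField I M) (p : M) : F.coord p p = (F p : E →L[ℝ] E) := by
  have h := TangentBundle.continuousLinearMapAt_trivializationAt_eq_core (I := I)
    (mem_chart_source H p)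
  have h' := TangentBundle.symmL_trivializationAt_eq_core (I := I) (mem_chart_source H p)
  ext w
  unfold EndField.coord ContinuousLinearMap.inCoordinates
  rw [h, h']
  refine ((tangentBundleCore I M).coordChange_self _ _ (mem_chart_source H p) _).trans ?_
  exact congrArg (F p) ((tangentBundleCore I M).coordChange_self _ _ (mem_chart_source H p) _)

/-- The complete lift of a tensor field satisfies `F^c (Z^c) = (F Z)^c` for every vector
field `Z`. -/
theorem EndField.completeLift_apply (F : EndField I M) (hF : F.IsSmooth) (Z : VField I M)
    (hZ : Z.IsSmooth) :
    F.completeLift.applyField Z.completeLift = (F.applyField Z).completeLift := by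
  funext q
  obtain ⟨p, v⟩ := q
  have hF' : MDifferentiableAt I 𝓘(ℝ, E →L[ℝ] E) (F.coord p) p :=
    ((mdifferentiableAt_hom_bundle _).1 ((hF p).mdifferentiableAt (by simp))).2
  have hZ' : MDifferentiableAt I 𝓘(ℝ, E) (Z.coord p) p := by
    have := (mdifferentiableAt_section _ _).1 ((hZ p).mdifferentiableAt (by simp))
    refine this.congr_of_eventuallyEq ?_
    filter_upwards [(trivializationAt E (TangentSpace I : M → Type _) p).open_baseSet.mem_nhds
      (FiberBundle.mem_baseSet_trivializationAt' p)] with x hx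
    exact (trivializationAt E (TangentSpace I : M → Type _) p).continuousLinearMapAt_apply_of_mem
      (R := ℝ) hx _
  have hpair : HasMFDerivAt I 𝓘(ℝ, (E →L[ℝ] E) × E) (fun x ↦ (F.coord p x, Z.coord p x)) p
      ((mfderiv I 𝓘(ℝ, E →L[ℝ] E) (F.coord p) p).prod (mfderiv I 𝓘(ℝ, E) (Z.coord p) p)) :=
    ⟨hF'.hasMFDerivAt.1.prodMk hZ'.hasMFDerivAt.1, hF'.hasMFDerivAt.2.prodMk hZ'.hasMFDerivAt.2⟩
  have hd : HasMFDerivAt I 𝓘(ℝ, E) (fun x ↦ F.coord p x (Z.coord p x)) p _ :=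
    (((isBoundedBilinearMap_apply (𝕜 := ℝ) (E := E) (F := E)).hasFDerivAt
      (F.coord p p, Z.coord p p)).hasMFDerivAt).comp p hpair
  have hFZ : (F.applyField Z).coord p =ᶠ[nhds p] fun x ↦ F.coord p x (Z.coord p x) := by
    filter_upwards [(trivializationAt E (TangentSpace I : M → Type _) p).open_baseSet.mem_nhds
      (FiberBundle.mem_baseSet_trivializationAt' p)] with x hx
    simp only [VField.coord, EndField.coord, EndField.applyField,
      ContinuousLinearMap.inCoordinates, ContinuousLinearMap.comp_apply]
    rw [Bundle.Trivialization.symmL_continuousLinearMapAt _ hx]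
  have key : mfderiv I 𝓘(ℝ, E) ((F.applyField Z).coord p) p = _ :=
    (hd.congr_of_eventuallyEq hFZ).mfderiv
  refine Prod.ext rfl ?_
  have k := congrArg (fun T : E →L[ℝ] E ↦ T v) key
  refine Eq.trans ?_ k.symm
  let B : E →L[ℝ] E := mfderiv I 𝓘(ℝ, E →L[ℝ] E) (F.coord p) p v
  let u : E := mfderiv I 𝓘(ℝ, E) (Z.coord p) p v
  let A : E →L[ℝ] E := F p
  let z : E := Z p
  have hA : F.coord p p = A := F.coord_self p
  have hz : Z.coord p p = z := Z.coord_self p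
  change B z + A u = F.coord p p u + B (Z.coord p p)
  rw [hA, hz, add_comm]

/-- An affine connection on `M`, i.e. a covariant derivative on `TM`, preserves the tensor field
`J`, i.e. `∇ J = 0`: one has `∇_X (J Y) = J (∇_X Y)` for all vector fields `X`, `Y`. -/
def Preserves (cov : CovariantDerivative I E (TangentSpace I : M → Type _))
    (J : EndField I M) : Prop :=
  ∀ (Y : VField I M), Y.IsSmooth → ∀ (p : M) (X : TangentSpace I p),
    cov (J.applyField Y) p X = J p (cov Y p X)

end Lifts

end ParaLift

end

open ParaLift

/-!
A chart in which a `(1,1)` tensor field has constant matrix carries a flat connection that is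
torsion-free and preserves the tensor field. Both properties are stable under convex combinations,
so a partition of unity glues these local connections to a global one. A torsion-free connection
which preserves `J` turns the brackets of the Nijenhuis tensor into covariant derivatives, and the
terms cancel in view of `J² = 1`.

It remains to find such charts for the complete lift. If `J` has constant matrix `S` in the chart
`φ`, then `J^c` has constant matrix `diag(S, S)` in the chart `(φ, dφ)` of the tangent bundle: this
is the derivative of the relation `dφ ∘ J = S ∘ dφ`, by the symmetry of second derivatives.
-/

noncomputable section

namespace ParaLift

open Filter VectorField
open scoped Topology

section TotalSpaceTopology

variable {B F : Type*} [TopologicalSpace B] [TopologicalSpace F] (E : B → Type*)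
  [TopologicalSpace (TotalSpace F E)] [∀ b, TopologicalSpace (E b)] [FiberBundle F E]

theorem t2Space_totalSpace [T2Space B] [T2Space F] : T2Space (TotalSpace F E) where
  t2 x y hxy := by
    by_cases hproj : x.proj = y.proj
    · let e := trivializationAt F E x.proj
      have hx : x ∈ e.source := FiberBundle.mem_trivializationAt_proj_source
      have hy : y ∈ e.source := by
        rw [e.mem_source, ← hproj]
        exact FiberBundle.mem_baseSet_trivializationAt' x.proj
      have : T2Space e.source :=
        e.toOpenPartialHomeomorph.toHomeomorphSourceTarget.isEmbedding.t2Space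
      exact separated_by_isOpenEmbedding e.open_source.isOpenEmbedding_subtypeVal
        (x := ⟨x, hx⟩) (y := ⟨y, hy⟩) fun h ↦ hxy (congrArg Subtype.val h)
    · exact separated_by_continuous (FiberBundle.continuous_proj F E) hproj

theorem secondCountableTopology_totalSpace [SecondCountableTopology B]
    [SecondCountableTopology F] : SecondCountableTopology (TotalSpace F E) := by
  obtain ⟨s, hs, hcover⟩ := TopologicalSpace.countable_cover_nhds fun b : B ↦
    (trivializationAt F E b).open_baseSet.mem_nhds (FiberBundle.mem_baseSet_trivializationAt' b)
  have := hs.to_subtype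
  have (b : s) : SecondCountableTopology (trivializationAt F E b.1).source :=
    (trivializationAt F E b.1).toOpenPartialHomeomorph.secondCountableTopology_source
  refine TopologicalSpace.secondCountableTopology_of_countable_cover
    (fun b : s ↦ (trivializationAt F E b.1).open_source) (Set.eq_univ_of_forall fun x ↦ ?_)
  obtain ⟨b, hb, hx⟩ := Set.mem_iUnion₂.1 (hcover.symm ▸ Set.mem_univ x.proj)
  exact Set.mem_iUnion.2 ⟨⟨b, hb⟩, (Trivialization.mem_source _).2 hx⟩

end TotalSpaceTopology

section Gluing

variable {E : Type*} [NormedAddCommGroup E] [NormedSpace ℝ E]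
  {H : Type*} [TopologicalSpace H] {I : ModelWithCorners ℝ E H}
  {M : Type*} [TopologicalSpace M] [ChartedSpace H M]
  {F : Type*} [NormedAddCommGroup F] [NormedSpace ℝ F] {V : M → Type*}
  [TopologicalSpace (TotalSpace F V)] [∀ x, AddCommGroup (V x)] [∀ x, Module ℝ (V x)]
  [∀ x, TopologicalSpace (V x)] [∀ x, IsTopologicalAddGroup (V x)]
  [∀ x, ContinuousSMul ℝ (V x)] [FiberBundle F V]
  {ι : Type*} (f : SmoothPartitionOfUnity ι I M)
  (cov : ι → (Π x : M, V x) → Π x : M, TangentSpace I x →L[ℝ] V x)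

/-- The sum of a family of local covariant derivatives weighted by a partition of unity, as an
operator on sections. -/
def gluedDerivative (σ : Π x : M, V x) (x : M) : TangentSpace I x →L[ℝ] V x :=
  ∑ᶠ i, f i x • cov i σ x

theorem gluedDerivative_eq_sum (σ : Π x : M, V x) (x : M) :
    gluedDerivative f cov σ x = ∑ i ∈ f.finsupport x, f i x • cov i σ x :=
  (f.sum_finsupport_smul_eq_finsum x fun i _ ↦ cov i σ x).symm

variable {f cov} {U : ι → Set M}

theorem mem_of_mem_finsupport (hU : f.IsSubordinate U) {x : M} {i : ι}
    (hi : i ∈ f.finsupport x) : x ∈ U i :=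
  hU i (subset_tsupport _ ((f.mem_finsupport x).1 hi))

theorem isCovariantDerivativeOn_gluedDerivative (hU : f.IsSubordinate U)
    (hcov : ∀ i, IsCovariantDerivativeOn F (cov i) (U i)) :
    IsCovariantDerivativeOn F (gluedDerivative f cov) Set.univ := by
  have hpoint (x : M) : IsCovariantDerivativeOn F
      (fun σ y ↦ ∑ i : f.finsupport x, f i x • cov i σ y) {x} :=
    IsCovariantDerivativeOn.finite_affine_combination
      (fun i : f.finsupport x ↦
        (hcov i).mono (Set.singleton_subset_iff.2 (mem_of_mem_finsupport hU i.2)))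
      (f := fun i _ ↦ f i x) (funext fun _ ↦ by
        rw [Finset.sum_apply, Finset.sum_coe_sort (f.finsupport x) fun i ↦ f i x]
        exact f.sum_finsupport x (Set.mem_univ x))
  have heq (σ : Π x : M, V x) (x : M) :
      gluedDerivative f cov σ x = ∑ i : f.finsupport x, f i x • cov i σ x := by
    rw [gluedDerivative_eq_sum, ← Finset.sum_coe_sort]
  exact
    { add := fun {_ _ x} hσ hσ' _ ↦ by
        simpa only [heq] using (hpoint x).add hσ hσ' (Set.mem_singleton x)
      leibniz := fun {_ _ x} hσ hg _ ↦ by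
        simpa only [heq] using (hpoint x).leibniz hσ hg (Set.mem_singleton x) }

theorem contMDiffCovariantDerivativeOn_gluedDerivative [IsManifold I ∞ M]
    [VectorBundle ℝ F V] (hU : f.IsSubordinate U)
    (hopen : ∀ i, IsOpen (U i))
    (hcov : ∀ i, ContMDiffCovariantDerivativeOn F ∞ (cov i) (U i)) :
    ContMDiffCovariantDerivativeOn F ∞ (gluedDerivative f cov) Set.univ where
  contMDiff hσ := by
    refine (ContMDiff.finsum_section_of_locallyFinite
      (f.locallyFinite.subset fun i x hx h ↦ hx (by simp [h])) fun i ↦ ?_).contMDiffOn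
    exact (f i).contMDiff.contMDiffOn.smul_section_of_tsupport (hopen i) (hU i)
      ((hcov i).contMDiff (hσ.mono (Set.subset_univ _)))

/-- The connection glued from a family of local covariant derivatives by a partition of unity. -/
def gluedConnection (hU : f.IsSubordinate U)
    (hcov : ∀ i, IsCovariantDerivativeOn F (cov i) (U i)) : CovariantDerivative I F V where
  toFun := gluedDerivative f cov
  isCovariantDerivativeOnUniv := isCovariantDerivativeOn_gluedDerivative hU hcov

end Gluing

section Forms

variable {E : Type*} [NormedAddCommGroup E] [NormedSpace ℝ E]
  {H : Type*} [TopologicalSpace H] {I : ModelWithCorners ℝ E H}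
  {M : Type*} [TopologicalSpace M] [ChartedSpace H M] [IsManifold I ∞ M]
  {F : Type*} [NormedAddCommGroup F] [NormedSpace ℝ F]

theorem eventually_mem_baseSet (x : M) :
    ∀ᶠ y in 𝓝 x, y ∈ (trivializationAt E (TangentSpace I : M → Type _) x).baseSet :=
  (trivializationAt E (TangentSpace I : M → Type _) x).open_baseSet.mem_nhds
    (FiberBundle.mem_baseSet_trivializationAt' x)

theorem VField.coord_eventuallyEq_trivializationAt (X : VField I M) (x : M) :
    X.coord x =ᶠ[𝓝 x] fun y ↦ (trivializationAt E (TangentSpace I : M → Type _) x ⟨y, X y⟩).2 := by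
  filter_upwards [eventually_mem_baseSet (I := I) x] with y hy
  exact Trivialization.continuousLinearMapAt_apply_of_mem (R := ℝ) _ hy _

theorem VField.mdifferentiableAt_coord {X : VField I M} {x : M} (hX : MDiffAt (T% X) x) :
    MDifferentiableAt I 𝓘(ℝ, E) (X.coord x) x :=
  ((mdifferentiableAt_section _ _).1 hX).congr_of_eventuallyEq
    (X.coord_eventuallyEq_trivializationAt x)

theorem VField.contMDiffAt_coord {X : VField I M} {x : M} (hX : CMDiffAt ∞ (T% X) x) :
    ContMDiffAt I 𝓘(ℝ, E) ∞ (X.coord x) x :=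
  ((contMDiffAt_section _).1 hX).congr_of_eventuallyEq (X.coord_eventuallyEq_trivializationAt x)

/-- The coefficients of the `F`-valued one-form `A` at points `y` near `x`, in the coordinates
given by the preferred chart at `x`. -/
def formCoord (A : Π y : M, TangentSpace I y →L[ℝ] F) (x y : M) : E →L[ℝ] F :=
  A y ∘L (trivializationAt E (TangentSpace I : M → Type _) x).symmL ℝ y

theorem formCoord_apply_coord_eventuallyEq (A : Π y : M, TangentSpace I y →L[ℝ] F)
    (X : VField I M) (x : M) :
    (fun y ↦ A y (X y)) =ᶠ[𝓝 x] fun y ↦ formCoord A x y (X.coord x y) := by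
  filter_upwards [eventually_mem_baseSet (I := I) x] with y hy
  rw [formCoord, VField.coord, ContinuousLinearMap.comp_apply,
    Trivialization.symmL_continuousLinearMapAt _ hy]

theorem mdifferentiableAt_form_apply {A : Π y : M, TangentSpace I y →L[ℝ] F} {x : M}
    (hA : MDifferentiableAt I 𝓘(ℝ, E →L[ℝ] F) (formCoord A x) x) {X : VField I M}
    (hX : MDiffAt (T% X) x) : MDifferentiableAt I 𝓘(ℝ, F) (fun y ↦ A y (X y)) x :=
  (hA.clm_apply (VField.mdifferentiableAt_coord hX)).congr_of_eventuallyEq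
    (formCoord_apply_coord_eventuallyEq A X x)

theorem contMDiffAt_form_apply {A : Π y : M, TangentSpace I y →L[ℝ] F} {x : M}
    (hA : ContMDiffAt I 𝓘(ℝ, E →L[ℝ] F) ∞ (formCoord A x) x) {X : VField I M}
    (hX : CMDiffAt ∞ (T% X) x) : ContMDiffAt I 𝓘(ℝ, F) ∞ (fun y ↦ A y (X y)) x :=
  (hA.clm_apply (VField.contMDiffAt_coord hX)).congr_of_eventuallyEq
    (formCoord_apply_coord_eventuallyEq A X x)

theorem contMDiffAt_formCoord_mvfderiv {f : M → F} {x : M}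
    (hf : ContMDiffAt I 𝓘(ℝ, F) ∞ f x) :
    ContMDiffAt I 𝓘(ℝ, E →L[ℝ] F) ∞ (formCoord (mvfderiv I f) x) x := by
  refine (hf.mfderiv_const (m := ∞) (by simp)).congr_of_eventuallyEq (.of_forall fun y ↦ ?_)
  simp only [inTangentCoordinates, ContinuousLinearMap.inCoordinates,
    TangentBundle.continuousLinearMapAt_model_space]
  rfl

/-- Smoothness of a `(1,1)` tensor field at a point. -/
def EndField.IsSmoothAt (J : EndField I M) (x : M) : Prop :=
  ContMDiffAt I (I.prod 𝓘(ℝ, E →L[ℝ] E)) ∞ (fun y : M ↦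
    (⟨y, J y⟩ : TotalSpace (E →L[ℝ] E) (fun y : M ↦ TangentSpace I y →L[ℝ] TangentSpace I y))) x

theorem EndField.IsSmoothAt.congr_of_eventuallyEq {J J' : EndField I M} {x : M}
    (hJ : J.IsSmoothAt x) (h : ∀ᶠ y in 𝓝 x, J' y = J y) : J'.IsSmoothAt x :=
  ContMDiffAt.congr_of_eventuallyEq hJ (h.mono fun y hy ↦ by simp only [hy])

theorem isSmoothAt_inverse_comp [CompleteSpace E] {D A : Π y : M, TangentSpace I y →L[ℝ] E}
    {x : M} (hinv : ∀ᶠ y in 𝓝 x, (D y).IsInvertible)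
    (hD : ContMDiffAt I 𝓘(ℝ, E →L[ℝ] E) ∞ (formCoord D x) x)
    (hA : ContMDiffAt I 𝓘(ℝ, E →L[ℝ] E) ∞ (formCoord A x) x) :
    EndField.IsSmoothAt (fun y ↦ (D y).inverse ∘L A y) x := by
  let e := trivializationAt E (TangentSpace I : M → Type _) x
  have hsymmL : ∀ y (hy : y ∈ e.baseSet), e.symmL ℝ y = (e.continuousLinearEquivAt ℝ y hy).symm :=
    fun y hy ↦ ContinuousLinearMap.ext fun v ↦ by
      simp [Trivialization.symm_continuousLinearEquivAt_eq _ hy]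
  have hDinv : (formCoord D x x).IsInvertible := by
    rw [formCoord, hsymmL x (FiberBundle.mem_baseSet_trivializationAt' x)]
    exact hinv.self_of_nhds.comp ContinuousLinearMap.isInvertible_equiv
  have hDinvSmooth : ContMDiffAt I 𝓘(ℝ, E →L[ℝ] E) ∞ (fun y ↦ (formCoord D x y).inverse) x :=
    hDinv.contDiffAt_map_inverse.contMDiffAt.comp x hD
  refine (contMDiffAt_hom_bundle _).2 ⟨contMDiffAt_id, ?_⟩
  refine (hDinvSmooth.clm_comp hA).congr_of_eventuallyEq ?_
  filter_upwards [eventually_mem_baseSet (I := I) x] with y hy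
  rw [formCoord, hsymmL y hy, ContinuousLinearMap.inverse_comp_equiv]
  refine ContinuousLinearMap.ext fun v ↦ ?_
  exact Trivialization.continuousLinearMapAt_apply_of_mem (R := ℝ) _ hy _

end Forms

section Charts

variable {E : Type*} [NormedAddCommGroup E] [NormedSpace ℝ E]
  {H : Type*} [TopologicalSpace H] {I : ModelWithCorners ℝ E H}
  {M : Type*} [TopologicalSpace M] [ChartedSpace H M]

/-- The differential of a chart, as a one-form with values in the model space: its value at `v` is
the vector of components of `v` in the chart. -/
def chartDeriv (I : ModelWithCorners ℝ E H) (φ : OpenPartialHomeomorph M H) (x : M) :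
    TangentSpace I x →L[ℝ] E :=
  mvfderiv I (φ.extend I) x

theorem mdifferentiable_of_mem_maximalAtlas {φ : OpenPartialHomeomorph M H}
    (hφ : φ ∈ IsManifold.maximalAtlas I ∞ M) : φ.MDifferentiable I I :=
  ⟨(contMDiffOn_of_mem_maximalAtlas hφ).mdifferentiableOn (by simp),
    (contMDiffOn_symm_of_mem_maximalAtlas hφ).mdifferentiableOn (by simp)⟩

theorem chartDeriv_eq_mfderiv {φ : OpenPartialHomeomorph M H}
    (hφ : φ ∈ IsManifold.maximalAtlas I ∞ M) {x : M} (hx : x ∈ φ.source) :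
    chartDeriv I φ x = mfderiv I I φ x :=
  ((I.hasMFDerivAt (x := φ x)).comp x
    ((mdifferentiable_of_mem_maximalAtlas hφ).mdifferentiableAt hx).hasMFDerivAt).mfderiv

theorem isInvertible_chartDeriv {φ : OpenPartialHomeomorph M H}
    (hφ : φ ∈ IsManifold.maximalAtlas I ∞ M) {x : M} (hx : x ∈ φ.source) :
    (chartDeriv I φ x).IsInvertible :=
  ⟨(mdifferentiable_of_mem_maximalAtlas hφ).mfderiv hx, (chartDeriv_eq_mfderiv hφ hx).symm⟩

variable [IsManifold I ∞ M] {φ : OpenPartialHomeomorph M H}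
  (hφ : φ ∈ IsManifold.maximalAtlas I ∞ M) {x : M} (hx : x ∈ φ.source)
include hφ hx

theorem contMDiffAt_formCoord_chartDeriv :
    ContMDiffAt I 𝓘(ℝ, E →L[ℝ] E) ∞ (formCoord (chartDeriv I φ) x) x :=
  contMDiffAt_formCoord_mvfderiv (φ.contMDiffAt_extend hφ hx)

theorem mdifferentiableAt_chartDeriv_apply {X : VField I M} (hX : MDiffAt (T% X) x) :
    MDifferentiableAt I 𝓘(ℝ, E) (fun y ↦ chartDeriv I φ y (X y)) x :=
  mdifferentiableAt_form_apply
    ((contMDiffAt_formCoord_chartDeriv hφ hx).mdifferentiableAt (by simp)) hX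

theorem contMDiffAt_chartDeriv_apply {X : VField I M} (hX : CMDiffAt ∞ (T% X) x) :
    ContMDiffAt I 𝓘(ℝ, E) ∞ (fun y ↦ chartDeriv I φ y (X y)) x :=
  contMDiffAt_form_apply (contMDiffAt_formCoord_chartDeriv hφ hx) hX

theorem isSmoothAt_chartDeriv_inverse_comp [CompleteSpace E]
    {A : Π y : M, TangentSpace I y →L[ℝ] E}
    (hA : ContMDiffAt I 𝓘(ℝ, E →L[ℝ] E) ∞ (formCoord A x) x) :
    EndField.IsSmoothAt (fun y ↦ (chartDeriv I φ y).inverse ∘L A y) x :=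
  isSmoothAt_inverse_comp
    (eventually_of_mem (φ.open_source.mem_nhds hx) fun _ ↦ isInvertible_chartDeriv hφ)
    (contMDiffAt_formCoord_chartDeriv hφ hx) hA

end Charts

section ChartConnection

variable {E : Type*} [NormedAddCommGroup E] [NormedSpace ℝ E]
  {H : Type*} [TopologicalSpace H] {I : ModelWithCorners ℝ E H}
  {M : Type*} [TopologicalSpace M] [ChartedSpace H M]

/-- The flat connection of the chart `φ`, which differentiates the components of vector fields in
`φ`; it is meaningful on `φ.source` only. -/
def chartConnection (I : ModelWithCorners ℝ E H) (φ : OpenPartialHomeomorph M H) (X : VField I M)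
    (x : M) : TangentSpace I x →L[ℝ] TangentSpace I x :=
  (chartDeriv I φ x).inverse ∘L mvfderiv I (fun y ↦ chartDeriv I φ y (X y)) x

theorem chartDeriv_chartConnection {φ : OpenPartialHomeomorph M H}
    (hφ : φ ∈ IsManifold.maximalAtlas I ∞ M) {x : M} (hx : x ∈ φ.source) (X : VField I M)
    (v : TangentSpace I x) :
    chartDeriv I φ x (chartConnection I φ X x v) =
      mvfderiv I (fun y ↦ chartDeriv I φ y (X y)) x v :=
  (isInvertible_chartDeriv hφ hx).self_apply_inverse _

variable [IsManifold I ∞ M] {φ : OpenPartialHomeomorph M H}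
  (hφ : φ ∈ IsManifold.maximalAtlas I ∞ M)
include hφ

theorem isCovariantDerivativeOn_chartConnection :
    IsCovariantDerivativeOn E (chartConnection I φ) φ.source where
  add {X Y x} hX hY hx := by
    have hadd : (fun y ↦ chartDeriv I φ y ((X + Y) y)) =
        (fun y ↦ chartDeriv I φ y (X y)) + fun y ↦ chartDeriv I φ y (Y y) :=
      funext fun y ↦ map_add (chartDeriv I φ y) _ _
    rw [chartConnection, hadd, mvfderiv_add (mdifferentiableAt_chartDeriv_apply hφ hx hX)
      (mdifferentiableAt_chartDeriv_apply hφ hx hY), ContinuousLinearMap.comp_add]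
    rfl
  leibniz {X g x} hX hg hx := by
    have hsmul : (fun y ↦ chartDeriv I φ y ((g • X) y)) = g • fun y ↦ chartDeriv I φ y (X y) :=
      funext fun y ↦ map_smul (chartDeriv I φ y) _ _
    rw [chartConnection, hsmul, mvfderiv_smul hg (mdifferentiableAt_chartDeriv_apply hφ hx hX)]
    ext v
    simp [chartConnection, (isInvertible_chartDeriv hφ hx).inverse_apply_self]

theorem contMDiffCovariantDerivativeOn_chartConnection [CompleteSpace E] :
    ContMDiffCovariantDerivativeOn E ∞ (chartConnection I φ) φ.source where
  contMDiff {X} hX x hx :=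
    have hXx : CMDiffAt ∞ (T% X) x := hX.contMDiffAt (φ.open_source.mem_nhds hx)
    (isSmoothAt_chartDeriv_inverse_comp hφ hx (contMDiffAt_formCoord_mvfderiv
      (contMDiffAt_chartDeriv_apply hφ hx hXx))).contMDiffWithinAt

end ChartConnection

section Torsion

variable {E : Type*} [NormedAddCommGroup E] [NormedSpace ℝ E]

theorem mlieBracket_eq_lieBracket (V W : Π x : E, TangentSpace 𝓘(ℝ, E) x) :
    mlieBracket 𝓘(ℝ, E) V W = lieBracket ℝ V W := by
  rw [← mlieBracketWithin_univ, mlieBracketWithin_eq_lieBracketWithin]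
  exact lieBracketWithin_univ

theorem mdifferentiableAt_vectorField {V : E → E} {u : E} (hV : DifferentiableAt ℝ V u) :
    MDifferentiableAt 𝓘(ℝ, E) 𝓘(ℝ, E).tangent
      (fun y ↦ (⟨y, V y⟩ : TangentBundle 𝓘(ℝ, E) E)) u := by
  refine (mdifferentiableAt_totalSpace _ _).2 ⟨mdifferentiableAt_id, ?_⟩
  convert! hV.mdifferentiableAt with y
  simp

variable {H : Type*} [TopologicalSpace H] {I : ModelWithCorners ℝ E H}
  {M : Type*} [TopologicalSpace M] [ChartedSpace H M]

/-- The components of the vector field `X` in the chart `φ`, as functions of the coordinates. -/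
def chartRep (I : ModelWithCorners ℝ E H) (φ : OpenPartialHomeomorph M H) (X : VField I M) :
    E → E :=
  (fun y ↦ chartDeriv I φ y (X y)) ∘ (φ.extend I).symm

theorem chartRep_extend (φ : OpenPartialHomeomorph M H) (X : VField I M) {x : M}
    (hx : x ∈ φ.source) : chartRep I φ X (φ.extend I x) = chartDeriv I φ x (X x) := by
  rw [chartRep, Function.comp_apply, φ.extend_left_inv hx]

theorem mpullback_chartRep {φ : OpenPartialHomeomorph M H}
    (hφ : φ ∈ IsManifold.maximalAtlas I ∞ M) (X : VField I M) {x : M} (hx : x ∈ φ.source) :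
    mpullback I 𝓘(ℝ, E) (φ.extend I) (chartRep I φ X) x = X x :=
  (congrArg (chartDeriv I φ x).inverse (chartRep_extend φ X hx)).trans
    ((isInvertible_chartDeriv hφ hx).inverse_apply_self _)

variable [IsManifold I ∞ M] [I.Boundaryless] {φ : OpenPartialHomeomorph M H}
  (hφ : φ ∈ IsManifold.maximalAtlas I ∞ M) {x : M} (hx : x ∈ φ.source)
  {X Y : VField I M}
include hφ hx

omit [IsManifold I ∞ M] in
theorem mdifferentiableAt_extend_symm :
    MDifferentiableAt 𝓘(ℝ, E) I (φ.extend I).symm (φ.extend I x) :=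
  ((contMDiffOn_extend_symm hφ).contMDiffAt
    ((I.toHomeomorph.isOpenMap _ φ.open_target).mem_nhds
      ⟨φ x, φ.map_source hx, rfl⟩)).mdifferentiableAt (by simp)

theorem differentiableAt_chartRep (hX : MDiffAt (T% X) x) :
    DifferentiableAt ℝ (chartRep I φ X) (φ.extend I x) := by
  refine (MDifferentiableAt.comp (I' := I) _ ?_
    (mdifferentiableAt_extend_symm hφ hx)).differentiableAt
  rw [φ.extend_left_inv hx]
  exact mdifferentiableAt_chartDeriv_apply hφ hx hX

theorem fderiv_chartRep (hX : MDiffAt (T% X) x) (v : TangentSpace I x) :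
    fderiv ℝ (chartRep I φ X) (φ.extend I x) (chartDeriv I φ x v) =
      mvfderiv I (fun y ↦ chartDeriv I φ y (X y)) x v := by
  have hcomp : (fun y ↦ chartDeriv I φ y (X y)) =ᶠ[𝓝 x] chartRep I φ X ∘ φ.extend I :=
    eventually_of_mem (φ.open_source.mem_nhds hx) fun y hy ↦ (chartRep_extend φ X hy).symm
  have hderiv := ((differentiableAt_chartRep hφ hx hX).hasFDerivAt.hasMFDerivAt.comp x
    ((φ.contMDiffAt_extend hφ hx).mdifferentiableAt (by simp)).hasMFDerivAt)
  exact (congrArg (fun T : E →L[ℝ] E ↦ T v)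
    (hderiv.congr_of_eventuallyEq hcomp).mfderiv).symm

theorem chartDeriv_mlieBracket [CompleteSpace E] (hX : MDiffAt (T% X) x) (hY : MDiffAt (T% Y) x) :
    chartDeriv I φ x (mlieBracket I X Y x) =
      mvfderiv I (fun y ↦ chartDeriv I φ y (Y y)) x (X x) -
        mvfderiv I (fun y ↦ chartDeriv I φ y (X y)) x (Y x) := by
  have hpull (Z : VField I M) : mpullback I 𝓘(ℝ, E) (φ.extend I) (chartRep I φ Z) =ᶠ[𝓝 x] Z :=
    eventually_of_mem (φ.open_source.mem_nhds hx) fun _ ↦ mpullback_chartRep hφ Z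
  have : IsManifold I (minSmoothness ℝ 2) M := by
    rw [minSmoothness_of_isRCLikeNormedField]
    infer_instance
  have hbracket := mpullback_mlieBracket (n := ∞)
    (mdifferentiableAt_vectorField (differentiableAt_chartRep hφ hx hX))
    (mdifferentiableAt_vectorField (differentiableAt_chartRep hφ hx hY))
    (φ.contMDiffAt_extend hφ hx)
    (by rw [minSmoothness_of_isRCLikeNormedField]; exact ENat.LEInfty.out)
  rw [← (hpull X).mlieBracket_vectorField_eq (hpull Y), ← hbracket, mpullback_apply]
  refine ((isInvertible_chartDeriv hφ hx).self_apply_inverse _).trans ?_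
  refine (congrFun (mlieBracket_eq_lieBracket (chartRep I φ X) (chartRep I φ Y)) _).trans ?_
  rw [lieBracket, chartRep_extend φ X hx, chartRep_extend φ Y hx, fderiv_chartRep hφ hx hY,
    fderiv_chartRep hφ hx hX]

theorem chartConnection_sub_chartConnection [CompleteSpace E] (hX : MDiffAt (T% X) x)
    (hY : MDiffAt (T% Y) x) :
    chartConnection I φ Y x (X x) - chartConnection I φ X x (Y x) = mlieBracket I X Y x := by
  apply (isInvertible_chartDeriv hφ hx).injective
  rw [map_sub, chartDeriv_chartConnection hφ hx, chartDeriv_chartConnection hφ hx,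
    chartDeriv_mlieBracket hφ hx hX hY]

end Torsion

section Integrable

variable {E : Type*} [NormedAddCommGroup E] [NormedSpace ℝ E]
  {H : Type*} [TopologicalSpace H] {I : ModelWithCorners ℝ E H}
  {M : Type*} [TopologicalSpace M] [ChartedSpace H M]

/-- The `(1,1)` tensor field `J` has the constant matrix `S` in the chart `φ`. -/
def EndField.HasConstantMatrix (J : EndField I M) (φ : OpenPartialHomeomorph M H)
    (S : E →L[ℝ] E) : Prop :=
  ∀ y ∈ φ.source, ∀ v, chartDeriv I φ y (J y v) = S (chartDeriv I φ y v)

/-- Integrability of a `(1,1)` tensor field: around every point there is a smooth chart in which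
its matrix is constant. The matrix may depend on the chart. -/
def EndField.IsIntegrable (J : EndField I M) : Prop :=
  ∀ x : M, ∃ φ ∈ IsManifold.maximalAtlas I ∞ M, x ∈ φ.source ∧
    ∃ S : E →L[ℝ] E, J.HasConstantMatrix φ S

variable [IsManifold I ∞ M] {J : EndField I M} {φ : OpenPartialHomeomorph M H}
  {S : E →L[ℝ] E} {x : M} {X Y : VField I M}

theorem EndField.HasConstantMatrix.isSmoothAt [CompleteSpace E]
    (hS : J.HasConstantMatrix φ S) (hφ : φ ∈ IsManifold.maximalAtlas I ∞ M)
    (hx : x ∈ φ.source) : J.IsSmoothAt x := by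
  have hform : ContMDiffAt I 𝓘(ℝ, E →L[ℝ] E) ∞
      (formCoord (fun y ↦ S ∘L chartDeriv I φ y) x) x :=
    (contMDiffAt_const (c := S)).clm_comp (contMDiffAt_formCoord_chartDeriv hφ hx)
  refine (isSmoothAt_chartDeriv_inverse_comp hφ hx hform).congr_of_eventuallyEq ?_
  filter_upwards [φ.open_source.mem_nhds hx] with y hy
  have hinv := isInvertible_chartDeriv hφ hy
  refine ContinuousLinearMap.ext fun v ↦ hinv.injective ?_
  exact (hS y hy v).trans (hinv.self_apply_inverse _).symm

theorem EndField.HasConstantMatrix.chartConnection_applyField (hS : J.HasConstantMatrix φ S)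
    (hφ : φ ∈ IsManifold.maximalAtlas I ∞ M) (hx : x ∈ φ.source) (hX : MDiffAt (T% X) x)
    (v : TangentSpace I x) :
    chartConnection I φ (J.applyField X) x v = J x (chartConnection I φ X x v) := by
  have hcomp : (fun y ↦ chartDeriv I φ y (J.applyField X y)) =ᶠ[𝓝 x]
      fun y ↦ S (chartDeriv I φ y (X y)) :=
    eventually_of_mem (φ.open_source.mem_nhds hx) fun y hy ↦ hS y hy _
  have hderiv := S.hasMFDerivAt.comp x (mdifferentiableAt_chartDeriv_apply hφ hx hX).hasMFDerivAt
  apply (isInvertible_chartDeriv hφ hx).injective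
  rw [chartDeriv_chartConnection hφ hx, hS x hx, chartDeriv_chartConnection hφ hx]
  exact congrArg (fun T : TangentSpace I x →L[ℝ] E ↦ T v)
    (hderiv.congr_of_eventuallyEq hcomp).mfderiv

theorem EndField.IsIntegrable.isSmooth [CompleteSpace E] (hJ : J.IsIntegrable) : J.IsSmooth :=
  fun x ↦ let ⟨_, hφ, hx, _, hS⟩ := hJ x; hS.isSmoothAt hφ hx

theorem EndField.IsIntegrable.nijenhuis_eq_zero [CompleteSpace E] [I.Boundaryless]
    (hJ : J.IsIntegrable) (hsq : ∀ x v, J x (J x v) = v) (hX : X.IsSmooth) (hY : Y.IsSmooth) :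
    nijenhuis J X Y = 0 := by
  funext x
  obtain ⟨φ, hφ, hx, S, hS⟩ := hJ x
  have hdiff {Z : VField I M} (hZ : Z.IsSmooth) : MDiffAt (T% Z) x :=
    (hZ x).mdifferentiableAt (by simp)
  have hdiffJ {Z : VField I M} (hZ : Z.IsSmooth) : MDiffAt (T% (J.applyField Z)) x :=
    ((hJ.isSmooth x).clm_bundle_apply (hZ x)).mdifferentiableAt (by simp)
  have hbracket {Z W : VField I M} (hZ : MDiffAt (T% Z) x) (hW : MDiffAt (T% W) x) :=
    (chartConnection_sub_chartConnection hφ hx hZ hW).symm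
  have hparallel {Z : VField I M} (hZ : Z.IsSmooth) :=
    hS.chartConnection_applyField hφ hx (hdiff hZ)
  rw [nijenhuis, hbracket (hdiff hX) (hdiff hY), hbracket (hdiffJ hX) (hdiff hY),
    hbracket (hdiff hX) (hdiffJ hY), hbracket (hdiffJ hX) (hdiffJ hY),
    hparallel hX, hparallel hX, hparallel hY, hparallel hY]
  simp only [map_sub, hsq]
  rw [Pi.zero_apply]
  abel

section Glued

variable {ι : Type*} {f : SmoothPartitionOfUnity ι I M} {ψ : ι → OpenPartialHomeomorph M H}

theorem preserves_gluedConnection {T : ι → E →L[ℝ] E}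
    (hf : f.IsSubordinate fun i ↦ (ψ i).source)
    (hψ : ∀ i, ψ i ∈ IsManifold.maximalAtlas I ∞ M)
    (hT : ∀ i, J.HasConstantMatrix (ψ i) (T i)) :
    Preserves (gluedConnection hf fun i ↦ isCovariantDerivativeOn_chartConnection (hψ i)) J := by
  intro X hX x v
  change gluedDerivative f _ (J.applyField X) x v = J x (gluedDerivative f _ X x v)
  rw [gluedDerivative_eq_sum, gluedDerivative_eq_sum, sum_apply, sum_apply, map_sum]
  refine Finset.sum_congr rfl fun i hi ↦ ?_
  rw [smul_apply, smul_apply, map_smul, (hT i).chartConnection_applyField (hψ i)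
    (mem_of_mem_finsupport hf hi) ((hX x).mdifferentiableAt (by simp))]

theorem torsion_gluedConnection [FiniteDimensional ℝ E] [I.Boundaryless]
    (hf : f.IsSubordinate fun i ↦ (ψ i).source)
    (hψ : ∀ i, ψ i ∈ IsManifold.maximalAtlas I ∞ M) :
    (gluedConnection hf fun i ↦ isCovariantDerivativeOn_chartConnection (hψ i)).torsion = 0 := by
  have : CompleteSpace E := FiniteDimensional.complete ℝ E
  rw [CovariantDerivative.torsion_eq_zero_iff]
  intro X Y x hX hY
  change gluedDerivative f _ Y x (X x) - gluedDerivative f _ X x (Y x) = mlieBracket I X Y x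
  rw [gluedDerivative_eq_sum, gluedDerivative_eq_sum, sum_apply, sum_apply,
    ← Finset.sum_sub_distrib, ← one_smul ℝ (mlieBracket I X Y x),
    ← f.sum_finsupport x (Set.mem_univ x), Finset.sum_smul]
  refine Finset.sum_congr rfl fun i hi ↦ ?_
  rw [smul_apply, smul_apply, ← smul_sub, chartConnection_sub_chartConnection (hψ i)
    (mem_of_mem_finsupport hf hi) hX hY]

end Glued

theorem EndField.IsIntegrable.exists_torsionFree_connection [FiniteDimensional ℝ E]
    [I.Boundaryless] [T2Space M] [SigmaCompactSpace M] (hJ : J.IsIntegrable) :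
    ∃ cov : CovariantDerivative I E (TangentSpace I : M → Type _),
      CovariantDerivative.ContMDiffCovariantDerivative cov ∞ ∧ Preserves cov J ∧
        cov.torsion = 0 := by
  have : CompleteSpace E := FiniteDimensional.complete ℝ E
  choose φ hφ hx S hS using hJ
  obtain ⟨f, hf⟩ := SmoothPartitionOfUnity.exists_isSubordinate I isClosed_univ
    (fun x ↦ (φ x).source) (fun x ↦ (φ x).open_source)
    (fun x _ ↦ Set.mem_iUnion.2 ⟨x, hx x⟩)
  exact ⟨gluedConnection hf fun x ↦ isCovariantDerivativeOn_chartConnection (hφ x),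
    ⟨contMDiffCovariantDerivativeOn_gluedDerivative hf (fun x ↦ (φ x).open_source)
      fun x ↦ contMDiffCovariantDerivativeOn_chartConnection (hφ x)⟩,
    preserves_gluedConnection hf hφ hS, torsion_gluedConnection hf hφ⟩

end Integrable

section TangentChart

variable {E : Type*} [NormedAddCommGroup E] [NormedSpace ℝ E]
  {H : Type*} [TopologicalSpace H] {I : ModelWithCorners ℝ E H}
  {M : Type*} [TopologicalSpace M] [ChartedSpace H M] [IsManifold I ∞ M]

section TangentMap

variable {E' : Type*} [NormedAddCommGroup E'] [NormedSpace ℝ E']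
  {H' : Type*} [TopologicalSpace H'] {I' : ModelWithCorners ℝ E' H'}
  {M' : Type*} [TopologicalSpace M'] [ChartedSpace H' M']

theorem contMDiffOn_tangentMap [IsManifold I' ∞ M'] {f : M → M'} {s : Set M}
    (hf : ContMDiffOn I I' ∞ f s) (hs : IsOpen s) :
    ContMDiffOn I.tangent I'.tangent ∞ (tangentMap I I' f)
      (TotalSpace.proj ⁻¹' s : Set (TangentBundle I M)) :=
  (hf.contMDiffOn_tangentMapWithin (m := ∞) (by simp) hs.uniqueMDiffOn).congr fun q hq ↦ by
    simp only [tangentMap, tangentMapWithin, mfderivWithin_of_isOpen hs hq]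

omit [IsManifold I ∞ M] in
theorem tangentMap_symm_tangentMap {φ : OpenPartialHomeomorph M M'}
    (hφ : φ.MDifferentiable I I') {q : TangentBundle I M} (hq : q.proj ∈ φ.source) :
    tangentMap I' I φ.symm (tangentMap I I' φ q) = q :=
  TotalSpace.ext (φ.left_inv hq)
    (heq_of_eq (congrArg (fun T : E →L[ℝ] E ↦ T q.snd) (hφ.symm_comp_deriv hq)))

end TangentMap

/-- The chart `(x, v) ↦ (φ x, dφₓ v)` of the tangent bundle induced by a chart `φ` of the
manifold. -/
def tangentChart (φ : OpenPartialHomeomorph M H) (hφ : φ ∈ IsManifold.maximalAtlas I ∞ M) :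
    OpenPartialHomeomorph (TangentBundle I M) (ModelProd H E) where
  toFun q := tangentBundleModelSpaceHomeomorph I (tangentMap I I φ q)
  invFun z := tangentMap I I φ.symm ((tangentBundleModelSpaceHomeomorph I).symm z)
  source := TotalSpace.proj ⁻¹' φ.source
  target := Prod.fst ⁻¹' φ.target
  map_source' _ hq := φ.map_source hq
  map_target' _ hz := φ.map_target hz
  left_inv' q hq := by
    rw [Homeomorph.symm_apply_apply]
    exact tangentMap_symm_tangentMap (mdifferentiable_of_mem_maximalAtlas hφ) hq
  right_inv' z hz := by
    rw [← Homeomorph.eq_symm_apply]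
    exact tangentMap_symm_tangentMap (mdifferentiable_of_mem_maximalAtlas hφ).symm hz
  open_source := φ.open_source.preimage (FiberBundle.continuous_proj E (TangentSpace I))
  open_target := φ.open_target.preimage continuous_fst
  continuousOn_toFun := (tangentBundleModelSpaceHomeomorph I).continuous.comp_continuousOn
    (contMDiffOn_tangentMap (contMDiffOn_of_mem_maximalAtlas hφ) φ.open_source).continuousOn
  continuousOn_invFun :=
    (contMDiffOn_tangentMap (contMDiffOn_symm_of_mem_maximalAtlas hφ)
      φ.open_target).continuousOn.comp
    (tangentBundleModelSpaceHomeomorph I).symm.continuous.continuousOn (fun _ h ↦ h)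

variable {φ : OpenPartialHomeomorph M H} (hφ : φ ∈ IsManifold.maximalAtlas I ∞ M)

theorem tangentChart_mem_maximalAtlas :
    tangentChart φ hφ ∈ IsManifold.maximalAtlas I.tangent ∞ (TangentBundle I M) :=
  (tangentChart φ hφ).mem_maximalAtlas_of_contMDiffOn
    (contMDiff_tangentBundleModelSpaceHomeomorph.comp_contMDiffOn
      (contMDiffOn_tangentMap (contMDiffOn_of_mem_maximalAtlas hφ) φ.open_source))
    ((contMDiffOn_tangentMap (contMDiffOn_symm_of_mem_maximalAtlas hφ) φ.open_target).comp
      contMDiff_tangentBundleModelSpaceHomeomorph_symm.contMDiffOn fun _ h ↦ h)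

theorem tangentChart_extend_apply {q : TangentBundle I M} (hq : q.proj ∈ φ.source) :
    (tangentChart φ hφ).extend I.tangent q =
      (φ.extend I q.proj, chartDeriv I φ q.proj q.snd) := by
  rw [chartDeriv_eq_mfderiv hφ hq]
  rfl

end TangentChart

section Calculus

variable {E : Type*} [NormedAddCommGroup E] [NormedSpace ℝ E]
  {F : Type*} [NormedAddCommGroup F] [NormedSpace ℝ F]

/-- The tangent map `(x, v) ↦ (τ x, dτₓ v)` of a map `τ` between normed spaces, with the tangent
bundles identified with products. -/
def fderivPair (τ : E → F) (z : E × E) : F × F :=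
  (τ z.1, fderiv ℝ τ z.1 z.2)

theorem fderiv_fderivPair {τ : E → F} {x : E} (hτ : DifferentiableAt ℝ τ x)
    (hτ' : DifferentiableAt ℝ (fderiv ℝ τ) x) (v a b : E) :
    fderiv ℝ (fderivPair τ) (x, v) (a, b) =
      (fderiv ℝ τ x a, fderiv ℝ (fderiv ℝ τ) x a v + fderiv ℝ τ x b) := by
  have hfst : HasFDerivAt (fun z : E × E ↦ τ z.1) _ (x, v) :=
    hτ.hasFDerivAt.comp (x, v) hasFDerivAt_fst
  have hfst' : HasFDerivAt (fun z : E × E ↦ fderiv ℝ τ z.1) _ (x, v) :=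
    hτ'.hasFDerivAt.comp (x, v) hasFDerivAt_fst
  have hpair : HasFDerivAt (fderivPair τ) _ (x, v) :=
    hfst.prodMk (hfst'.clm_apply hasFDerivAt_snd)
  rw [hpair.fderiv]
  simp [add_comm]

theorem fderiv_apply_add_of_comp_eventuallyEq {D : E → E →L[ℝ] F} {j : E → E →L[ℝ] E}
    {S : F →L[ℝ] F} {x : E} (hD : DifferentiableAt ℝ D x) (hj : DifferentiableAt ℝ j x)
    (hDj : (fun u ↦ D u ∘L j u) =ᶠ[𝓝 x] fun u ↦ S ∘L D u) (v a : E) :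
    fderiv ℝ D x v (j x a) + D x (fderiv ℝ j x v a) = S (fderiv ℝ D x v a) := by
  have hleft := hD.hasFDerivAt.clm_comp hj.hasFDerivAt
  have hright := (hasFDerivAt_const S x).clm_comp hD.hasFDerivAt
  have heq := congrArg (fun T : E →L[ℝ] E →L[ℝ] F ↦ T v a)
    ((hleft.congr_of_eventuallyEq hDj.symm).unique hright)
  simpa [add_comm] using heq

/- The first argument of the second derivative of `τ` is the direction of differentiation. The
lower left block `dj v` of the lift produces it with `v` in that slot, the tangent map with `v` in
the other one; its symmetry reconciles the two. -/
theorem fderiv_fderivPair_intertwines {τ : E → F} {x : E} (hτ : ContDiffAt ℝ 2 τ x)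
    {j : E → E →L[ℝ] E} (hj : DifferentiableAt ℝ j x) {S : F →L[ℝ] F}
    (hτj : (fun u ↦ fderiv ℝ τ u ∘L j u) =ᶠ[𝓝 x] fun u ↦ S ∘L fderiv ℝ τ u) (v a b : E) :
    fderiv ℝ (fderivPair τ) (x, v) (j x a, fderiv ℝ j x v a + j x b) =
      S.prodMap S (fderiv ℝ (fderivPair τ) (x, v) (a, b)) := by
  have hτ₁ : DifferentiableAt ℝ τ x := hτ.differentiableAt (by simp)
  have hτ₂ : DifferentiableAt ℝ (fderiv ℝ τ) x :=
    (hτ.fderiv_right (m := 1) (by norm_num)).differentiableAt (by simp)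
  have hsymm : IsSymmSndFDerivAt ℝ τ x := hτ.isSymmSndFDerivAt (by simp)
  have hpoint (c : E) : fderiv ℝ τ x (j x c) = S (fderiv ℝ τ x c) :=
    congrArg (fun T : E →L[ℝ] F ↦ T c) hτj.self_of_nhds
  have hderiv := fderiv_apply_add_of_comp_eventuallyEq hτ₂ hj hτj v a
  rw [fderiv_fderivPair hτ₁ hτ₂, fderiv_fderivPair hτ₁ hτ₂]
  refine Prod.ext (hpoint a) ?_
  change fderiv ℝ (fderiv ℝ τ) x (j x a) v + fderiv ℝ τ x (fderiv ℝ j x v a + j x b) =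
    S (fderiv ℝ (fderiv ℝ τ) x a v + fderiv ℝ τ x b)
  rw [map_add, map_add, hsymm (j x a) v, hsymm a v, hpoint, ← hderiv, add_assoc]

end Calculus

section CompleteLift

variable {E : Type*} [NormedAddCommGroup E] [NormedSpace ℝ E]
  {H : Type*} [TopologicalSpace H] {I : ModelWithCorners ℝ E H}
  {M : Type*} [TopologicalSpace M] [ChartedSpace H M]

theorem eventually_extChartAt_symm_mem_source [I.Boundaryless] {φ : OpenPartialHomeomorph M H}
    {p : M} (hp : p ∈ φ.source) :
    ∀ᶠ u in 𝓝 (extChartAt I p p),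
      u ∈ (extChartAt I p).target ∧ (extChartAt I p).symm u ∈ φ.source :=
  Eventually.and (extChartAt_target_mem_nhds p) ((continuousAt_extChartAt_symm p).preimage_mem_nhds
    (φ.open_source.mem_nhds (by rwa [extChartAt_to_inv])))

theorem extChartAt_symm_mem_chartAt_source {p : M} {u : E} (hu : u ∈ (extChartAt I p).target) :
    (extChartAt I p).symm u ∈ (chartAt H p).source := by
  simpa only [extChartAt_source] using (extChartAt I p).map_target hu

theorem mfderiv_eq_fderiv_comp_extChartAt_symm [I.Boundaryless] {F : Type*}
    [NormedAddCommGroup F] [NormedSpace ℝ F] {f : M → F} {x : M}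
    (hf : MDifferentiableAt I 𝓘(ℝ, F) f x) :
    mfderiv I 𝓘(ℝ, F) f x = fderiv ℝ (f ∘ (extChartAt I x).symm) (extChartAt I x x) := by
  refine (if_pos hf).trans ?_
  rw [I.range_eq_univ, fderivWithin_univ]
  rfl

/-- The transition map from the preferred chart at `p` to the chart `φ`. -/
def transitionMap (I : ModelWithCorners ℝ E H) (φ : OpenPartialHomeomorph M H) (p : M) : E → E :=
  φ.extend I ∘ (extChartAt I p).symm

variable [IsManifold I ∞ M]

theorem extChartAt_tangentBundle_self (q : TangentBundle I M) :
    extChartAt I.tangent q q = ((extChartAt I q.proj q.proj, q.snd) : E × E) := by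
  rw [FiberBundle.extChartAt]
  refine Prod.ext (by simp) ?_
  exact (tangentBundleCore I M).coordChange_self _ _ (mem_chart_source H q.proj) _

theorem extChartAt_tangentBundle_symm (q : TangentBundle I M) {u : E}
    (hu : u ∈ (extChartAt I q.proj).target) (w : E) :
    (extChartAt I.tangent q).symm (u, w) =
      (⟨(extChartAt I q.proj).symm u, (trivializationAt E (TangentSpace I : M → Type _)
        q.proj).symmL ℝ ((extChartAt I q.proj).symm u) w⟩ : TangentBundle I M) := by
  have hbase : (extChartAt I q.proj).symm u ∈
      (trivializationAt E (TangentSpace I : M → Type _) q.proj).baseSet :=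
    extChartAt_symm_mem_chartAt_source hu
  rw [FiberBundle.extChartAt, Trivialization.symmL_apply _ hbase]
  exact ((trivializationAt E (TangentSpace I : M → Type _) q.proj).mk_symm hbase w).symm

theorem EndField.IsSmoothAt.contMDiffAt_coord {J : EndField I M} {p : M} (hJ : J.IsSmoothAt p) :
    ContMDiffAt I 𝓘(ℝ, E →L[ℝ] E) ∞ (J.coord p) p :=
  ((contMDiffAt_hom_bundle _).1 hJ).2

variable [I.Boundaryless] {φ : OpenPartialHomeomorph M H}
  (hφ : φ ∈ IsManifold.maximalAtlas I ∞ M)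

theorem contMDiffAt_extChartAt_symm {p : M} {u : E} (hu : u ∈ (extChartAt I p).target) :
    ContMDiffAt 𝓘(ℝ, E) I ∞ (extChartAt I p).symm u :=
  (contMDiffOn_extChartAt_symm p).contMDiffAt (extChartAt_target_mem_nhds' hu)

include hφ

theorem contDiffAt_transitionMap {p : M} {u : E} (hu : u ∈ (extChartAt I p).target)
    (hφu : (extChartAt I p).symm u ∈ φ.source) : ContDiffAt ℝ ∞ (transitionMap I φ p) u :=
  ((φ.contMDiffAt_extend hφ hφu).comp u (contMDiffAt_extChartAt_symm hu)).contDiffAt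

theorem fderiv_transitionMap {p : M} {u : E} (hu : u ∈ (extChartAt I p).target)
    (hφu : (extChartAt I p).symm u ∈ φ.source) :
    fderiv ℝ (transitionMap I φ p) u =
      formCoord (chartDeriv I φ) p ((extChartAt I p).symm u) := by
  have hsymm := ((contMDiffAt_extChartAt_symm hu).mdifferentiableAt (by simp)).hasMFDerivAt
  have hextend := ((φ.contMDiffAt_extend hφ hφu).mdifferentiableAt (by simp)).hasMFDerivAt
  rw [formCoord, TangentBundle.symmL_trivializationAt (extChartAt_symm_mem_chartAt_source hu),
    I.range_eq_univ, mfderivWithin_univ, (extChartAt I p).right_inv hu, ← mfderiv_eq_fderiv]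
  exact (hextend.comp u hsymm).mfderiv

theorem tangentChart_extend_comp_extChartAt_symm {q : TangentBundle I M}
    (hq : q.proj ∈ φ.source) :
    (tangentChart φ hφ).extend I.tangent ∘ (extChartAt I.tangent q).symm
      =ᶠ[𝓝 ((extChartAt I q.proj q.proj, q.snd) : E × E)]
        fderivPair (transitionMap I φ q.proj) := by
  filter_upwards [continuousAt_fst.eventually (eventually_extChartAt_symm_mem_source hq)]
  rintro ⟨u, w⟩ ⟨hu, hφu⟩
  rw [Function.comp_apply, extChartAt_tangentBundle_symm q hu, tangentChart_extend_apply hφ hφu,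
    fderivPair, fderiv_transitionMap hφ hu hφu]
  rfl

theorem chartDeriv_tangentChart {q : TangentBundle I M} (hq : q.proj ∈ φ.source) :
    chartDeriv I.tangent (tangentChart φ hφ) q =
      fderiv ℝ (fderivPair (transitionMap I φ q.proj))
        ((extChartAt I q.proj q.proj, q.snd) : E × E) := by
  have hmdiff : MDifferentiableAt I.tangent 𝓘(ℝ, E × E)
      ((tangentChart φ hφ).extend I.tangent) q :=
    ((tangentChart φ hφ).contMDiffAt_extend (tangentChart_mem_maximalAtlas hφ)
      hq).mdifferentiableAt (by simp)
  refine (mfderiv_eq_fderiv_comp_extChartAt_symm hmdiff).trans ?_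
  rw [extChartAt_tangentBundle_self,
    (tangentChart_extend_comp_extChartAt_symm hφ hq).fderiv_eq]

theorem EndField.HasConstantMatrix.fderiv_transitionMap_comp {J : EndField I M} {S : E →L[ℝ] E}
    (hS : J.HasConstantMatrix φ S) {p : M} (hp : p ∈ φ.source) :
    (fun u ↦ fderiv ℝ (transitionMap I φ p) u ∘L J.coord p ((extChartAt I p).symm u))
      =ᶠ[𝓝 (extChartAt I p p)] fun u ↦ S ∘L fderiv ℝ (transitionMap I φ p) u := by
  filter_upwards [eventually_extChartAt_symm_mem_source hp] with u ⟨hu, hφu⟩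
  have hbase : (extChartAt I p).symm u ∈
      (trivializationAt E (TangentSpace I : M → Type _) p).baseSet :=
    extChartAt_symm_mem_chartAt_source hu
  ext v
  simp only [fderiv_transitionMap hφ hu hφu, formCoord, EndField.coord,
    ContinuousLinearMap.inCoordinates, ContinuousLinearMap.comp_apply]
  rw [Trivialization.symmL_continuousLinearMapAt _ hbase, hS _ hφu]

theorem EndField.HasConstantMatrix.completeLift [CompleteSpace E] {J : EndField I M}
    {S : E →L[ℝ] E} (hS : J.HasConstantMatrix φ S) :
    J.completeLift.HasConstantMatrix (tangentChart φ hφ) (S.prodMap S) := by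
  rintro q (hq : q.proj ∈ φ.source) w
  have hp := mem_extChartAt_target (I := I) q.proj
  let u : E := extChartAt I q.proj q.proj
  let j : E → E →L[ℝ] E := J.coord q.proj ∘ (extChartAt I q.proj).symm
  have hcoord := (hS.isSmoothAt hφ hq).contMDiffAt_coord.mdifferentiableAt (by simp)
  have hj : DifferentiableAt ℝ j u := by
    refine (MDifferentiableAt.comp (I' := I) _ ?_
      ((contMDiffAt_extChartAt_symm hp).mdifferentiableAt (by simp))).differentiableAt
    rwa [extChartAt_to_inv]
  have hju : j u = J q.proj :=
    (congrArg (J.coord q.proj) (extChartAt_to_inv q.proj)).trans (J.coord_self q.proj)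
  have hlift : J.completeLift q w = (j u w.1, fderiv ℝ j u q.snd w.1 + j u w.2) := by
    rw [hju, ← mfderiv_eq_fderiv_comp_extChartAt_symm hcoord]
    rfl
  have hτ := contDiffAt_transitionMap hφ hp (by rwa [extChartAt_to_inv])
  rw [chartDeriv_tangentChart hφ hq, hlift]
  exact fderiv_fderivPair_intertwines (hτ.of_le ENat.LEInfty.out) hj
    (hS.fderiv_transitionMap_comp hφ hq) q.snd w.1 w.2

omit hφ in
theorem EndField.IsIntegrable.completeLift [CompleteSpace E] {J : EndField I M}
    (hJ : J.IsIntegrable) : J.completeLift.IsIntegrable := fun q ↦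
  let ⟨φ, hφ, hq, S, hS⟩ := hJ q.proj
  ⟨tangentChart φ hφ, tangentChart_mem_maximalAtlas hφ, hq, S.prodMap S, hS.completeLift hφ⟩

end CompleteLift

section Paracomplex

variable {E : Type*} [NormedAddCommGroup E] [NormedSpace ℝ E] {m : ℕ}
  (L : E ≃L[ℝ] (Fin m → ℝ) × (Fin m → ℝ))

/-- The endomorphism of `E` which exchanges the two halves of the linear coordinates `L`, that is,
the matrix of a paracomplex structure in adapted coordinates. -/
def swapVia : E →L[ℝ] E :=
  (L.trans ((ContinuousLinearEquiv.prodComm ℝ (Fin m → ℝ) (Fin m → ℝ)).trans L.symm) : E ≃L[ℝ] E)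

theorem apply_swapVia (v : E) : L (swapVia L v) = (L v).swap := by
  simp [swapVia]

/-- The linear coordinates `(x, y, x', y')` on `E × E` given by two copies of `L`, regrouped as
`((x, x'), (y, y'))`, so that the exchange of halves of `L × L` becomes an exchange of halves. -/
def doubleCoords : (E × E) ≃L[ℝ] (Fin (m + m) → ℝ) × (Fin (m + m) → ℝ) :=
  let c : ((Fin m → ℝ) × (Fin m → ℝ)) ≃L[ℝ] (Fin (m + m) → ℝ) :=
    ContinuousLinearEquiv.ofFinrankEq (by simp)
  (L.prodCongr L).trans
    ((ContinuousLinearEquiv.prodProdProdComm ℝ _ _ _ _).trans (c.prodCongr c))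

theorem doubleCoords_prodMap_swapVia (w : E × E) :
    doubleCoords L ((swapVia L).prodMap (swapVia L) w) = (doubleCoords L w).swap := by
  simp [doubleCoords, apply_swapVia, ContinuousLinearEquiv.prodProdProdComm]

/- `diag(1, -1)` anticommutes with the exchange of the factors, so its conjugate maps one eigenspace
of `f` onto the other. -/
theorem finrank_eigenspace_one_eq_of_conj_swap {R V W : Type*} [CommRing R] [AddCommGroup V]
    [Module R V] [AddCommGroup W] [Module R W] (f : Module.End R V) (e : V ≃ₗ[R] W × W)
    (h : ∀ v, e (f v) = (e v).swap) :
    Module.finrank R (f.eigenspace 1) = Module.finrank R (f.eigenspace (-1)) := by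
  let k : V ≃ₗ[R] V :=
    e.trans (((LinearEquiv.refl R W).prodCongr (LinearEquiv.neg R)).trans e.symm)
  have hek (v : V) : e (k v) = ((e v).1, -(e v).2) := by simp [k]
  have hanti (v : V) : f (k v) = -k (f v) := e.injective (by simp [h, hek])
  have hmap : (f.eigenspace 1).map (k : V →ₗ[R] V) = f.eigenspace (-1) := by
    ext v
    obtain ⟨u, rfl⟩ := k.surjective v
    rw [Submodule.mem_map_equiv, Module.End.mem_eigenspace_iff, Module.End.mem_eigenspace_iff,
      one_smul, neg_one_smul, LinearEquiv.symm_apply_apply, hanti, neg_inj, k.injective.eq_iff]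
  rw [← hmap]
  exact (k.submoduleMap (f.eigenspace 1)).finrank_eq

variable {L} {H : Type*} [TopologicalSpace H] {I : ModelWithCorners ℝ E H}
  {M : Type*} [TopologicalSpace M] [ChartedSpace H M] {J : EndField I M}

theorem EndField.hasConstantMatrix_swapVia_iff {φ : OpenPartialHomeomorph M H} :
    J.HasConstantMatrix φ (swapVia L) ↔
      ∀ y ∈ φ.source, ∀ v, L (chartDeriv I φ y (J y v)) = (L (chartDeriv I φ y v)).swap := by
  simp only [EndField.HasConstantMatrix, ← apply_swapVia, L.injective.eq_iff]

variable [IsManifold I ∞ M]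

theorem isParacomplex_of_swapping_charts [CompleteSpace E]
    (hJ : ∀ p : M, ∃ φ ∈ IsManifold.maximalAtlas I ∞ M, p ∈ φ.source ∧
      ∃ (m : ℕ) (L : E ≃L[ℝ] (Fin m → ℝ) × (Fin m → ℝ)),
        ∀ y ∈ φ.source, ∀ v, L (chartDeriv I φ y (J y v)) = (L (chartDeriv I φ y v)).swap) :
    IsParacomplex J where
  smooth p := by
    obtain ⟨φ, hφ, hp, m, L, hL⟩ := hJ p
    exact (EndField.hasConstantMatrix_swapVia_iff.2 hL).isSmoothAt hφ hp
  sq p v := by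
    obtain ⟨φ, hφ, hp, m, L, hL⟩ := hJ p
    refine (isInvertible_chartDeriv hφ hp).injective (L.injective ?_)
    rw [hL p hp, hL p hp, Prod.swap_swap]
  rank_eq p := by
    obtain ⟨φ, hφ, hp, m, L, hL⟩ := hJ p
    obtain ⟨e, he⟩ := isInvertible_chartDeriv hφ hp
    refine finrank_eigenspace_one_eq_of_conj_swap _ (e.trans L).toLinearEquiv fun v ↦ ?_
    have := hL p hp v
    rw [← he] at this
    exact this
  integrable := hJ

theorem IsParacomplex.isIntegrable (hJ : IsParacomplex J) : J.IsIntegrable := fun p ↦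
  let ⟨φ, hφ, hp, _, L, hL⟩ := hJ.integrable p
  ⟨φ, hφ, hp, swapVia L, EndField.hasConstantMatrix_swapVia_iff.2 hL⟩

theorem IsParacomplex.completeLift [CompleteSpace E] [I.Boundaryless] (hJ : IsParacomplex J) :
    IsParacomplex J.completeLift := by
  refine isParacomplex_of_swapping_charts fun q ↦ ?_
  obtain ⟨φ, hφ, hq, m, L, hL⟩ := hJ.integrable q.proj
  refine ⟨tangentChart φ hφ, tangentChart_mem_maximalAtlas hφ, hq, m + m, doubleCoords L,
    fun y hy v ↦ ?_⟩
  rw [(EndField.hasConstantMatrix_swapVia_iff.2 hL).completeLift hφ y hy v]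
  exact doubleCoords_prodMap_swapVia L _

end Paracomplex

end ParaLift

end

theorem mainTheorem2_general {E : Type*} [NormedAddCommGroup E] [NormedSpace ℝ E]
    [FiniteDimensional ℝ E] {H : Type*} [TopologicalSpace H] {I : ModelWithCorners ℝ E H}
    [I.Boundaryless] {M : Type*} [TopologicalSpace M] [T2Space M] [SecondCountableTopology M]
    [ChartedSpace H M] [IsManifold I ∞ M] {J : EndField I M} (hJ : IsParacomplex J) :
    IsParacomplex J.completeLift ∧
    (∀ Z W : VField I.tangent (TangentBundle I M),
      Z.IsSmooth → W.IsSmooth → nijenhuis J.completeLift Z W = 0) ∧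
    ∃ cov : CovariantDerivative I.tangent (E × E)
        (TangentSpace I.tangent : TangentBundle I M → Type _),
      CovariantDerivative.ContMDiffCovariantDerivative cov ∞ ∧
      Preserves cov J.completeLift ∧
      cov.torsion = 0 := by
  have : CompleteSpace E := FiniteDimensional.complete ℝ E
  have : T2Space (TangentBundle I M) := t2Space_totalSpace _
  have : SecondCountableTopology (TangentBundle I M) := secondCountableTopology_totalSpace _
  have : LocallyCompactSpace (TangentBundle I M) :=
    Manifold.locallyCompact_of_finiteDimensional I.tangent
  have hlift : J.completeLift.IsIntegrable := hJ.isIntegrable.completeLift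
  exact ⟨hJ.completeLift, fun _ _ ↦ hlift.nijenhuis_eq_zero hJ.completeLift.sq,
    hlift.exists_torsionFree_connection⟩

theorem mainTheorem2 (m : ℕ) (M : Type*) [TopologicalSpace M] [T2Space M]
    [SecondCountableTopology M] [ChartedSpace (EuclideanSpace ℝ (Fin (2 * m))) M]
    [IsManifold (𝓡 (2 * m)) ∞ M]
    (J : EndField (𝓡 (2 * m)) M) (hJ : IsParacomplex J) :
    IsParacomplex J.completeLift ∧
    (∀ Z W : VField (𝓡 (2 * m)).tangent (TangentBundle (𝓡 (2 * m)) M),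
      Z.IsSmooth → W.IsSmooth → nijenhuis J.completeLift Z W = 0) ∧
    ∃ cov : CovariantDerivative (𝓡 (2 * m)).tangent
        (EuclideanSpace ℝ (Fin (2 * m)) × EuclideanSpace ℝ (Fin (2 * m)))
        (TangentSpace (𝓡 (2 * m)).tangent : TangentBundle (𝓡 (2 * m)) M → Type _),
      CovariantDerivative.ContMDiffCovariantDerivative cov ∞ ∧
      Preserves cov J.completeLift ∧
      cov.torsion = 0 :=
  mainTheorem2_general hJ
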